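/- Let $\mathbb K$ be $\mathbb R$ or $\mathbb C$. For $p\in\mathbb N_0\cup\{\infty\}$ let $C^p[0,1]$ be the vector space over $\mathbb K$ of all $p$ times continuously differentiable functions $f:[0,1]\to\mathbb K$ (derivatives at the endpoints are one-sided), endowed with its natural topology, i.e. that of uniform convergence on $[0,1]$ of all derivatives $f^{(k)}$ with $k$ finite and $k\le p$. A subset $A$ of a topological vector space $X$ is called maximal dense-lineable if $A\cup\{0\}$ contains a dense vector subspace $M$ of $X$ with $\dim M=\dim X$ (as cardinal numbers). (a) For every $p\in\mathbb N_0$, the set of all $f\in C^p[0,1]$ such that $f^{(p)}$ is differentiable at no point of $[0,1]$ is maximal dense-lineable in $C^p[0,1]$. (b) The set of all $f\in C^\infty[0,1]$ that are analytic at no point of $[0,1]$ is maximal dense-lineable in $C^\infty[0,1]$. Here $f$ is analytic at $x_0\in[0,1]$ if on some neighbourhood of $x_0$ in $[0,1]$ it is the sum of a convergent power series centred at $x_0$. (c) If $\mathbb K=\mathbb C$, the set of all $f\in C^\infty[0,1]$ that have a Pringsheim singularity at every point of $[0,1]$ is maximal dense-lineable in $C^\infty[0,1]$. Here $f$ has a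 Pringsheim singularity at $x_0\in[0,1]$ if the radius of convergence of its Taylor series $\sum_{n\ge0}\frac{f^{(n)}(x_0)}{n!}(x-x_0)^n$ is zero. -/

import Mathlib

open Set
open scoped Nat

noncomputable section

/-- A subset `A` of a topological vector space `X` over `𝕜` is *maximal dense-lineable* if
`A ∪ {0}` contains a dense vector subspace `M` of `X` with `dim M = dim X`. -/
def MaximalDenseLineable (𝕜 : Type*) {X : Type*} [Field 𝕜] [AddCommGroup X] [Module 𝕜 X]
    [TopologicalSpace X] (A : Set X) : Prop :=
  ∃ M : Submodule 𝕜 X, (M : Set X) ⊆ A ∪ {0} ∧ Dense (M : Set X) ∧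
    Module.rank 𝕜 M = Module.rank 𝕜 X

/-- The functions `f : [0,1] → 𝕜` of class `C^p`, `p ∈ ℕ ∪ {∞}`. Regularity and derivatives are
relative to `[0,1]` (one-sided at the endpoints), so the values of the extension
`IccExtend zero_le_one f : ℝ → 𝕜` outside `[0,1]` play no role. -/
def cpSubmodule (𝕜 : Type*) [RCLike 𝕜] (p : ℕ∞) : Submodule 𝕜 (Icc (0 : ℝ) 1 → 𝕜) where
  carrier := {f | ContDiffOn ℝ p (IccExtend zero_le_one f) (Icc 0 1)}
  add_mem' hf hg := ContDiffOn.add hf hg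
  zero_mem' := contDiffOn_const (c := (0 : 𝕜))
  smul_mem' c _ hf := ContDiffOn.const_smul c hf

/-- The space `C^p[0,1]` of `𝕜`-valued functions, `p ∈ ℕ ∪ {∞}`. It is a type of its own, so that
it does not inherit the topology of pointwise convergence. -/
def CpSpace (𝕜 : Type*) [RCLike 𝕜] (p : ℕ∞) : Type _ := cpSubmodule 𝕜 p

namespace CpSpace

variable {𝕜 : Type*} [RCLike 𝕜] {p : ℕ∞}

instance : AddCommGroup (CpSpace 𝕜 p) := inferInstanceAs (AddCommGroup (cpSubmodule 𝕜 p))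

instance : Module 𝕜 (CpSpace 𝕜 p) := inferInstanceAs (Module 𝕜 (cpSubmodule 𝕜 p))

/-- An element of `C^p[0,1]`, extended to `ℝ` by constants. -/
def ext (f : CpSpace 𝕜 p) : ℝ → 𝕜 := IccExtend zero_le_one f.1

/-- The `k`-th derivative `f^(k)` of `f` relative to `[0,1]`; it is meaningful on `[0,1]`. -/
def der (k : ℕ) (f : CpSpace 𝕜 p) : ℝ → 𝕜 := iteratedDerivWithin k f.ext (Icc 0 1)

theorem contDiffOn_ext (f : CpSpace 𝕜 p) : ContDiffOn ℝ p f.ext (Icc 0 1) := f.2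

/-- For `k ≤ p`, the linear map `f ↦ f^(k)` from `C^p[0,1]` to `C[0,1]`. -/
def derivLM (k : ℕ) (hk : (k : ℕ∞) ≤ p) : CpSpace 𝕜 p →ₗ[𝕜] C(Icc (0 : ℝ) 1, 𝕜) where
  toFun f := ⟨fun x => f.der k x,
    ((f.contDiffOn_ext.continuousOn_iteratedDerivWithin (by exact_mod_cast hk)
      (uniqueDiffOn_Icc zero_lt_one)).domRestrict)⟩
  map_add' f g := by
    ext x
    exact iteratedDerivWithin_add x.2 (uniqueDiffOn_Icc zero_lt_one)
      ((f.contDiffOn_ext x x.2).of_le (by exact_mod_cast hk))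
      ((g.contDiffOn_ext x x.2).of_le (by exact_mod_cast hk))
  map_smul' c f := by
    ext x
    exact iteratedDerivWithin_const_smul x.2 (uniqueDiffOn_Icc zero_lt_one) c
      ((f.contDiffOn_ext x x.2).of_le (by exact_mod_cast hk))

/-- The natural topology of `C^p[0,1]`: uniform convergence on `[0,1]` of every derivative of
(finite) order at most `p`. -/
instance : TopologicalSpace (CpSpace 𝕜 p) :=
  ⨅ (k : ℕ) (hk : (k : ℕ∞) ≤ p), TopologicalSpace.induced (derivLM k hk) inferInstance

instance : IsTopologicalAddGroup (CpSpace 𝕜 p) :=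
  topologicalAddGroup_iInf fun k => topologicalAddGroup_iInf fun hk =>
    topologicalAddGroup_induced (derivLM (𝕜 := 𝕜) k hk)

instance : ContinuousSMul 𝕜 (CpSpace 𝕜 p) :=
  continuousSMul_iInf fun k => continuousSMul_iInf fun hk =>
    continuousSMul_induced (derivLM (𝕜 := 𝕜) k hk)

/-- `f` is analytic at `x ∈ [0,1]`: on a neighbourhood of `x` in `[0,1]` it is the sum of a
convergent power series centred at `x`. -/
def IsAnalyticAt (f : CpSpace 𝕜 p) (x : ℝ) : Prop := AnalyticWithinAt ℝ f.ext (Icc 0 1) x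

/-- The Taylor series `∑ (f^(n)(x) / n!) z^n` of a smooth function `f` at `x ∈ [0,1]`. -/
def taylorAt (f : CpSpace 𝕜 ⊤) (x : ℝ) : FormalMultilinearSeries 𝕜 𝕜 𝕜 :=
  FormalMultilinearSeries.ofScalars 𝕜 fun n : ℕ => f.der n x / (n ! : 𝕜)

/-- `f` has a Pringsheim singularity at `x ∈ [0,1]`: the radius of convergence of its Taylor
series at `x` is zero. -/
def HasPringsheimSingularityAt (f : CpSpace 𝕜 ⊤) (x : ℝ) : Prop := (f.taylorAt x).radius = 0

end CpSpace

end

/-! For a bounded sequence `d` let `L d` be the lacunary series with terms `2 ^ (-α k) cos (4 ^ (k ^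
2) x) d k`. It depends linearly and continuously on `d`. For suitable `α`, as soon as `d` is not a
null sequence, `L d` is bad at every point of `[0,1]`, and stays so after a polynomial is added: at
the scale of each large `k` with `‖d k‖ ≥ δ`, the `k`-th term outweighs all the others together
(`norm_sub_le_norm_tsum_of_dominant`).

Lineability is then linear algebra. There are continuum many bounded sequences `e t` no nontrivial
combination of which is null (`exists_bounded_family_mod_null`). Perturb monomials by multiples of
`L (e t)`, each monomial infinitely often and with multiples tending to zero. Nontrivial
combinations are a polynomial plus `L` of a non-null sequence, hence bad; the closure of the span
contains all polynomials, which are dense; and the dimension is the continuum, the cardinality of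
the whole space.

For (a) the `p`-th derivative has amplitudes `2 ^ (-k ^ 2)` at frequencies `4 ^ (k ^ 2)`, which
forces unbounded difference quotients. For (b) and (c) one choice of `α` gives `‖f^(n)(x)‖ ≥ (n!)²`
for infinitely many `n` at every `x`, which excludes both analyticity and a positive radius of
convergence. -/

open Filter Topology Polynomial

/-! ### Polynomial approximation together with derivatives -/

section PolynomialApproximation

variable {𝕜 : Type*} [RCLike 𝕜]

theorem Polynomial.exists_derivative_eq {K : Type*} [Field K] [CharZero K] (Q : K[X]) :
    ∃ P : K[X], derivative P = Q := by
  induction Q using Polynomial.induction_on' with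
  | add p q hp hq =>
    obtain ⟨P, rfl⟩ := hp
    obtain ⟨R, rfl⟩ := hq
    exact ⟨P + R, derivative_add⟩
  | monomial n a =>
    refine ⟨monomial (n + 1) (a / (n + 1)), ?_⟩
    rw [derivative_monomial]
    congr 1
    have : (n : K) + 1 ≠ 0 := by exact_mod_cast n.succ_ne_zero
    push_cast
    field_simp

/-- The function `ℝ → 𝕜` given by a polynomial over `𝕜`. -/
def polyFun (P : 𝕜[X]) (x : ℝ) : 𝕜 := P.eval (x : 𝕜)

theorem hasDerivAt_polyFun (P : 𝕜[X]) (x : ℝ) :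
    HasDerivAt (polyFun P) (polyFun (derivative P) x) x := by
  have h := ((P.hasDerivAt (x : 𝕜)).hasFDerivAt.restrictScalars ℝ).comp_hasDerivAt x
    (RCLike.ofRealCLM (K := 𝕜)).hasDerivAt
  simpa [polyFun, Function.comp_def] using! h

theorem deriv_polyFun (P : 𝕜[X]) : deriv (polyFun P) = polyFun (derivative P) :=
  funext fun x => (hasDerivAt_polyFun P x).deriv

theorem iteratedDeriv_polyFun (n : ℕ) (P : 𝕜[X]) :
    iteratedDeriv n (polyFun P) = polyFun (derivative^[n] P) := by
  induction n generalizing P with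
  | zero => simp
  | succ n ih => rw [iteratedDeriv_succ', deriv_polyFun, ih, Function.iterate_succ_apply]

theorem contDiff_polyFun (P : 𝕜[X]) (n : ℕ∞) : ContDiff ℝ n (polyFun P) := by
  refine contDiff_of_differentiable_iteratedDeriv fun m _ => ?_
  rw [iteratedDeriv_polyFun]
  exact fun x => (hasDerivAt_polyFun _ x).differentiableAt

theorem exists_polyFun_near_of_continuousOn {f : ℝ → 𝕜} (hf : ContinuousOn f (Icc 0 1))
    {ε : ℝ} (hε : 0 < ε) : ∃ P : 𝕜[X], ∀ x ∈ Icc (0 : ℝ) 1, ‖f x - polyFun P x‖ ≤ ε := by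
  let F : C(unitInterval, 𝕜) := ⟨(Icc (0 : ℝ) 1).domRestrict f, hf.domRestrict⟩
  obtain ⟨n, hn⟩ := ((Metric.tendsto_nhds.1 (bernsteinApproximation_uniform F)) ε hε).exists
  refine ⟨∑ k : Fin (n + 1), C (F (bernstein.z k)) *
    (bernsteinPolynomial ℝ n k).map (algebraMap ℝ 𝕜), fun x hx => ?_⟩
  rw [dist_comm, ContinuousMap.dist_lt_iff hε] at hn
  have h := (hn ⟨x, hx⟩).le
  rw [dist_eq_norm, bernsteinApproximation.apply] at h
  have e : polyFun (∑ k : Fin (n + 1), C (F (bernstein.z k)) *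
      (bernsteinPolynomial ℝ n k).map (algebraMap ℝ 𝕜)) x
      = ∑ k : Fin (n + 1), bernstein n k ⟨x, hx⟩ • F (bernstein.z k) := by
    rw [polyFun, eval_finsetSum]
    refine Finset.sum_congr rfl fun k _ => ?_
    have : (x : 𝕜) = algebraMap ℝ 𝕜 x := rfl
    rw [eval_mul, eval_C, this, eval_map_apply, mul_comm, ← Algebra.smul_def]
    rfl
  rw [e]
  exact h

/-- Induction on `K`: approximate the derivative, then take an antiderivative of the approximating
polynomial. -/
theorem exists_polyFun_near (K : ℕ) {f : ℝ → 𝕜} (hf : ContDiffOn ℝ K f (Icc 0 1))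
    {ε : ℝ} (hε : 0 < ε) : ∃ P : 𝕜[X], ∀ j ≤ K, ∀ x ∈ Icc (0 : ℝ) 1,
      ‖iteratedDerivWithin j f (Icc 0 1) x - iteratedDeriv j (polyFun P) x‖ ≤ ε := by
  induction K generalizing f with
  | zero =>
    obtain ⟨P, hP⟩ := exists_polyFun_near_of_continuousOn hf.continuousOn hε
    refine ⟨P, fun j hj x hx => ?_⟩
    obtain rfl : j = 0 := by omega
    simpa using hP x hx
  | succ K ih =>
    have hu : UniqueDiffOn ℝ (Icc (0 : ℝ) 1) := uniqueDiffOn_Icc zero_lt_one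
    have hf' : ContDiffOn ℝ K (derivWithin f (Icc 0 1)) (Icc 0 1) :=
      hf.derivWithin hu (by norm_cast)
    obtain ⟨Q, hQ⟩ := ih hf'
    obtain ⟨R, rfl⟩ := Q.exists_derivative_eq
    -- The constant makes the polynomial agree with `f` at `0`; since `[0,1]` has length one, the
    -- mean value inequality then passes `ε` on without loss.
    refine ⟨R + C (f 0 - polyFun R 0), fun j hj x hx => ?_⟩
    have hd : derivative (R + C (f 0 - polyFun R 0)) = derivative R := by simp
    rcases j with _ | j
    · have hdf : DifferentiableOn ℝ f (Icc 0 1) := hf.differentiableOn (by simp)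
      have key := (convex_Icc (0 : ℝ) 1).norm_image_sub_le_of_norm_hasDerivWithin_le
        (f := fun y => f y - polyFun (R + C (f 0 - polyFun R 0)) y)
        (f' := fun y => derivWithin f (Icc 0 1) y - polyFun (derivative R) y) (C := ε)
        (fun y hy => ((hdf y hy).hasDerivWithinAt).sub
          (hd ▸ (hasDerivAt_polyFun (R + C (f 0 - polyFun R 0)) y).hasDerivWithinAt))
        (fun y hy => by simpa using hQ 0 (Nat.zero_le _) y hy)
        (left_mem_Icc.2 zero_le_one) hx
      have h0 : f 0 - polyFun (R + C (f 0 - polyFun R 0)) 0 = 0 := by simp [polyFun]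
      simp only [h0, sub_zero] at key
      simp only [iteratedDerivWithin_zero, iteratedDeriv_zero]
      refine key.trans (mul_le_of_le_one_right hε.le ?_)
      rw [Real.norm_eq_abs, abs_of_nonneg hx.1]
      exact hx.2
    · rw [iteratedDerivWithin_succ', iteratedDeriv_succ', deriv_polyFun, hd]
      exact hQ j (by omega) x hx

end PolynomialApproximation

/-! ### The space `C^p[0,1]`: density of polynomials and cardinality -/

namespace CpSpace

variable {𝕜 : Type*} [RCLike 𝕜] {p : ℕ∞}

/-- The restriction to `[0,1]` of a function of class `C^p` on `ℝ`. -/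
def ofContDiff (F : ℝ → 𝕜) (hF : ContDiff ℝ p F) : CpSpace 𝕜 p :=
  ⟨fun x => F x, hF.contDiffOn.congr fun _ hx => IccExtend_of_mem _ _ hx⟩

theorem der_eq_of_eqOn {f : CpSpace 𝕜 p} {F : ℝ → 𝕜} {n : ℕ} {x : ℝ} (hF : ContDiffAt ℝ n F x)
    (h : EqOn f.ext F (Icc 0 1)) (hx : x ∈ Icc (0 : ℝ) 1) : f.der n x = iteratedDeriv n F x := by
  rw [der, iteratedDerivWithin_congr h hx]
  exact iteratedDerivWithin_eq_iteratedDeriv (uniqueDiffOn_Icc zero_lt_one) hF hx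

theorem ofContDiff_ext_eqOn (F : ℝ → 𝕜) (hF : ContDiff ℝ p F) :
    EqOn (ofContDiff F hF).ext F (Icc 0 1) :=
  fun _ hx => IccExtend_of_mem _ _ hx

theorem der_ofContDiff {F : ℝ → 𝕜} (hF : ContDiff ℝ p F) {n : ℕ} (hn : (n : ℕ∞) ≤ p) {x : ℝ}
    (hx : x ∈ Icc (0 : ℝ) 1) : (ofContDiff F hF).der n x = iteratedDeriv n F x :=
  der_eq_of_eqOn (hF.contDiffAt.of_le (by exact_mod_cast hn)) (ofContDiff_ext_eqOn F hF) hx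

theorem der_add {n : ℕ} (hn : (n : ℕ∞) ≤ p) (f g : CpSpace 𝕜 p) {x : ℝ}
    (hx : x ∈ Icc (0 : ℝ) 1) : (f + g).der n x = f.der n x + g.der n x :=
  DFunLike.congr_fun ((derivLM n hn).map_add f g) ⟨x, hx⟩

theorem der_zero_elem {n : ℕ} (hn : (n : ℕ∞) ≤ p) {x : ℝ}
    (hx : x ∈ Icc (0 : ℝ) 1) : (0 : CpSpace 𝕜 p).der n x = 0 :=
  DFunLike.congr_fun (derivLM (𝕜 := 𝕜) n hn).map_zero ⟨x, hx⟩

theorem tendsto_iff {α : Type*} {l : Filter α} {u : α → CpSpace 𝕜 p} {f : CpSpace 𝕜 p} :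
    Tendsto u l (𝓝 f) ↔ ∀ (k : ℕ) (hk : (k : ℕ∞) ≤ p),
      Tendsto (fun a => derivLM k hk (u a)) l (𝓝 (derivLM k hk f)) := by
  have : 𝓝 f = ⨅ (k : ℕ) (hk : (k : ℕ∞) ≤ p), comap (derivLM k hk) (𝓝 (derivLM k hk f)) := by
    simp only [nhds_iInf, nhds_induced]
  simp only [this, tendsto_iInf, tendsto_comap_iff, Function.comp_def]

theorem continuous_iff {Y : Type*} [TopologicalSpace Y] {u : Y → CpSpace 𝕜 p} :
    Continuous u ↔ ∀ (k : ℕ) (hk : (k : ℕ∞) ≤ p), Continuous fun y => derivLM k hk (u y) := by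
  simp only [continuous_iff_continuousAt, ContinuousAt, tendsto_iff]
  exact ⟨fun h k hk y => h y k hk, fun h y k hk => h k hk y⟩

variable (𝕜 p) in
/-- Polynomials as elements of `C^p[0,1]`. -/
def polyLM : 𝕜[X] →ₗ[𝕜] CpSpace 𝕜 p where
  toFun P := ofContDiff (polyFun P) (contDiff_polyFun P p)
  map_add' _ _ := Subtype.ext <| funext fun _ => eval_add
  map_smul' _ _ := Subtype.ext <| funext fun _ => eval_smul ..

theorem der_polyLM (P : 𝕜[X]) {n : ℕ} (hn : (n : ℕ∞) ≤ p) {x : ℝ} (hx : x ∈ Icc (0 : ℝ) 1) :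
    (polyLM 𝕜 p P).der n x = polyFun (derivative^[n] P) x := by
  rw [← iteratedDeriv_polyFun]
  exact der_ofContDiff (contDiff_polyFun P p) hn hx

variable (𝕜 p) in
theorem denseRange_polyLM : DenseRange (polyLM 𝕜 p) := by
  intro f
  have h (m : ℕ) : ∃ P : 𝕜[X], ∀ j ≤ m, (j : ℕ∞) ≤ p → ∀ x ∈ Icc (0 : ℝ) 1,
      ‖f.der j x - iteratedDeriv j (polyFun P) x‖ ≤ 1 / ((m : ℝ) + 1) := by
    -- `K = min m p` is finite even for `p = ∞`.
    obtain ⟨K, hK⟩ := ENat.ne_top_iff_exists.1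
      (ne_top_of_le_ne_top (ENat.natCast_ne_top m) (min_le_left (m : ℕ∞) p))
    obtain ⟨P, hP⟩ := exists_polyFun_near (f := f.ext) K
      (f.contDiffOn_ext.of_le (by exact_mod_cast hK.trans_le (min_le_right _ _)))
      (ε := 1 / ((m : ℝ) + 1)) (by positivity)
    refine ⟨P, fun j hj hjp => hP j ?_⟩
    have : (j : ℕ∞) ≤ K := hK ▸ le_min (by exact_mod_cast hj) hjp
    exact_mod_cast this
  choose P hP using h
  refine mem_closure_of_tendsto (f := fun m => polyLM 𝕜 p (P m)) (b := atTop) ?_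
    (Eventually.of_forall fun m => mem_range_self _)
  refine tendsto_iff.2 fun k hk => ?_
  rw [tendsto_iff_norm_sub_tendsto_zero]
  refine squeeze_zero' (Eventually.of_forall fun _ => norm_nonneg _) ?_
    (tendsto_one_div_add_atTop_nhds_zero_nat (𝕜 := ℝ))
  filter_upwards [eventually_ge_atTop k] with m hm
  rw [ContinuousMap.norm_le _ (by positivity)]
  intro x
  rw [ContinuousMap.sub_apply, norm_sub_rev]
  have := hP m k hm hk x x.2
  rwa [← der_ofContDiff (contDiff_polyFun (P m) p) hk x.2] at this

/-- A continuous function is determined by its values on a countable dense set. -/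
theorem mk_le_continuum (𝕜 : Type) [RCLike 𝕜] (p : ℕ∞) :
    Cardinal.mk (CpSpace 𝕜 p) ≤ Cardinal.continuum := by
  let Φ : CpSpace 𝕜 p → ℕ → ℝ × ℝ := fun f n =>
    (RCLike.re (f.1 (TopologicalSpace.denseSeq (Icc (0 : ℝ) 1) n)),
      RCLike.im (f.1 (TopologicalSpace.denseSeq (Icc (0 : ℝ) 1) n)))
  have hc (f : CpSpace 𝕜 p) : Continuous f.1 := by
    have := f.contDiffOn_ext.continuousOn.domRestrict
    convert this using 1
    ext x
    simp [ext]
  have hΦ : Function.Injective Φ := by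
    intro f g hfg
    refine Subtype.ext (Continuous.ext_on (TopologicalSpace.denseRange_denseSeq _)
      (hc f) (hc g) ?_)
    rintro _ ⟨n, rfl⟩
    have := congrFun hfg n
    simp only [Φ, Prod.mk.injEq] at this
    exact RCLike.ext this.1 this.2
  refine (Cardinal.mk_le_of_injective hΦ).trans ?_
  simp [Cardinal.mk_real]

end CpSpace

/-! ### The abstract lineability criterion -/

section Lineability

/-- Let `e t` be the indicator of the pairs `(r, m) ∈ ℚ × ℕ` with `|t - r| < 1 / (m + 1)`. Along
pairs `(r n, n)` closing in on a point `t₀` of the support of `c`, the other points of the support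
eventually drop out, and the combination takes the constant value `c t₀ ≠ 0`. -/
theorem exists_bounded_family_mod_null (𝕜 : Type*) [RCLike 𝕜] :
    ∃ e : ℝ → lp (fun _ : ℕ => 𝕜) ⊤, (∀ t, ‖e t‖ ≤ 1) ∧ ∀ c : ℝ →₀ 𝕜, c ≠ 0 →
      ¬ Tendsto (fun k => Finsupp.linearCombination 𝕜 e c k) atTop (𝓝 0) := by
  classical
  let q : ℕ ≃ ℚ × ℕ := (Denumerable.eqv (ℚ × ℕ)).symm
  let a : ℝ → ℕ → 𝕜 := fun t k => if |t - (q k).1| < 1 / ((q k).2 + 1 : ℝ) then 1 else 0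
  have ha (t : ℝ) (k : ℕ) : ‖a t k‖ ≤ 1 := by
    simp only [a]
    split_ifs <;> simp
  refine ⟨fun t => ⟨a t, memℓp_infty ⟨1, by rintro _ ⟨k, rfl⟩; exact ha t k⟩⟩,
    fun t => lp.norm_le_of_forall_le zero_le_one (ha t), fun c hc => ?_⟩
  obtain ⟨t₀, ht₀⟩ := Finsupp.ne_iff.1 hc
  obtain ⟨η, hη, hgap⟩ : ∃ η > 0, ∀ t ∈ c.support, t ≠ t₀ → η ≤ |t - t₀| := by
    have : ∀ᶠ s in 𝓝 t₀, s ∉ ((c.support.erase t₀ : Finset ℝ) : Set ℝ) :=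
      (c.support.erase t₀).finite_toSet.isClosed.isOpen_compl.mem_nhds (by simp)
    obtain ⟨η, hη, h⟩ := Metric.eventually_nhds_iff.1 this
    refine ⟨η, hη, fun t ht hne => not_lt.1 fun hlt => ?_⟩
    exact h (y := t) (by rwa [Real.dist_eq]) (by simpa [hne] using ht)
  have hr (n : ℕ) : ∃ r : ℚ, |t₀ - r| < 1 / ((n : ℝ) + 1) :=
    Rat.denseRange_cast.exists_dist_lt t₀ (by positivity)
  choose r hr using hr
  have hinj : Function.Injective fun n : ℕ => q.symm (r n, n) := fun m n h =>
    (Prod.mk.inj (q.symm.injective h)).2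
  intro hlim
  have h0 := hlim.comp (Nat.cofinite_eq_atTop ▸ hinj.tendsto_cofinite)
  refine ht₀ (tendsto_nhds_unique (tendsto_const_nhds.congr' ?_) h0)
  have hsmall : ∀ᶠ n : ℕ in atTop, 1 / ((n : ℝ) + 1) < η / 2 :=
    (tendsto_one_div_add_atTop_nhds_zero_nat (𝕜 := ℝ)).eventually_lt_const (half_pos hη)
  filter_upwards [hsmall] with n hn
  have hval (t : ℝ) : a t (q.symm (r n, n)) =
      if |t - r n| < 1 / ((n : ℝ) + 1) then 1 else 0 := by
    simp only [a, Equiv.apply_symm_apply]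
  simp only [Function.comp_apply, Finsupp.linearCombination_apply, Finsupp.sum, lp.coeFn_sum,
    Finset.sum_apply, lp.coeFn_smul, Pi.smul_apply, smul_eq_mul, hval]
  rw [Finset.sum_eq_single t₀]
  · rw [if_pos (hr n), mul_one]
  · intro t ht hne
    rw [if_neg, mul_zero]
    intro hlt
    have h1 := hgap t ht hne
    have h2 := abs_sub_le t (r n) t₀
    rw [abs_sub_comm (r n : ℝ) t₀] at h2
    linarith [hr n]
  · intro h
    rw [Finsupp.notMem_support_iff.1 h, zero_mul]

theorem MaximalDenseLineable.mono {𝕜 X : Type*} [Field 𝕜] [AddCommGroup X] [Module 𝕜 X]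
    [TopologicalSpace X] {A B : Set X} (h : MaximalDenseLineable 𝕜 A) (hAB : A ⊆ B) :
    MaximalDenseLineable 𝕜 B :=
  let ⟨M, hM, hd, hr⟩ := h
  ⟨M, hM.trans (union_subset_union_left _ hAB), hd, hr⟩

/-- If perturbing the members of a dense subspace by the images under `L` of bounded sequences that
are not null sequences leads into `A`, then `A` is maximal dense-lineable. -/
theorem maximalDenseLineable_of_bounded_sequences {𝕜 X : Type} [RCLike 𝕜] [AddCommGroup X]
    [Module 𝕜 X] [TopologicalSpace X] [IsTopologicalAddGroup X] [ContinuousSMul 𝕜 X]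
    (hX : Cardinal.mk X ≤ Cardinal.continuum) {A : Set X} (hA0 : (0 : X) ∉ A)
    (L : lp (fun _ : ℕ => 𝕜) ⊤ →L[𝕜] X) (D : ℕ → X)
    (hD : Dense (Submodule.span 𝕜 (range D) : Set X))
    (hA : ∀ q ∈ Submodule.span 𝕜 (range D), ∀ d : lp (fun _ : ℕ => 𝕜) ⊤,
      ¬ Tendsto (fun k => d k) atTop (𝓝 0) → q + L d ∈ A) :
    MaximalDenseLineable 𝕜 A := by
  obtain ⟨e, he, hc⟩ := exists_bounded_family_mod_null 𝕜
  -- The natural number `t = Nat.pair n k` carries `D n` with weight `1 / (k + 1)`; these `t` alone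
  -- give density. The other `t` only supply dimension and need just a nonzero weight.
  let i : ℝ → ℕ := fun t => (Nat.unpair ⌊t⌋₊).1
  let w : ℝ → 𝕜 := fun t => 1 / ((Nat.unpair ⌊t⌋₊).2 + 1)
  have hw (t : ℝ) : w t ≠ 0 := by
    simp only [w]
    exact one_div_ne_zero (Nat.cast_add_one_ne_zero _)
  let v : ℝ → X := fun t => D (i t) + w t • L (e t)
  have hcomb (c : ℝ →₀ 𝕜) (hne : c ≠ 0) : Finsupp.linearCombination 𝕜 v c ∈ A := by
    -- The weights are absorbed into the coefficients; being nonzero, they keep the combination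
    -- nontrivial.
    let c' : ℝ →₀ 𝕜 := Finsupp.onFinset c.support (fun t => c t * w t) fun t h =>
      Finsupp.mem_support_iff.2 (left_ne_zero_of_mul h)
    have hc' (t : ℝ) : c' t = c t * w t := rfl
    have hne' : c' ≠ 0 := by
      obtain ⟨t, ht⟩ := Finsupp.ne_iff.1 hne
      exact Finsupp.ne_iff.2 ⟨t, by rw [hc']; exact mul_ne_zero ht (hw t)⟩
    have hsupp : c'.support ⊆ c.support := fun t ht => by
      rw [Finsupp.mem_support_iff, hc'] at ht
      exact Finsupp.mem_support_iff.2 (left_ne_zero_of_mul ht)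
    have : Finsupp.linearCombination 𝕜 v c = Finsupp.linearCombination 𝕜 (fun t => D (i t)) c +
        L (Finsupp.linearCombination 𝕜 e c') := by
      rw [Finsupp.linearCombination_apply 𝕜 c', Finsupp.sum_of_support_subset c' hsupp _ (by simp)]
      simp only [Finsupp.linearCombination_apply, Finsupp.sum, map_sum, map_smul, v, smul_add,
        Finset.sum_add_distrib, hc', smul_smul]
    rw [this]
    refine hA _ ?_ _ (hc c' hne')
    rw [Finsupp.linearCombination_apply]
    exact Submodule.sum_mem _ fun t _ =>
      Submodule.smul_mem _ _ (Submodule.subset_span (mem_range_self _))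
  have hli : LinearIndependent 𝕜 v := by
    rw [linearIndependent_iff]
    intro c h
    by_contra hne
    exact hA0 (h ▸ hcomb c hne)
  refine ⟨Submodule.span 𝕜 (range v), ?_, ?_, ?_⟩
  · intro x hx
    obtain ⟨c, rfl⟩ := (Finsupp.mem_span_range_iff_exists_finsupp).1 hx
    by_cases h : c = 0
    · right
      simp [h]
    · left
      rw [← Finsupp.linearCombination_apply]
      exact hcomb c h
  · have hsub : Submodule.span 𝕜 (range D) ≤ (Submodule.span 𝕜 (range v)).topologicalClosure := by
      rw [Submodule.span_le]
      rintro _ ⟨n, rfl⟩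
      let t : ℕ → ℝ := fun k => (Nat.pair n k : ℕ)
      have hv (k : ℕ) : v (t k) = D n + L ((1 / ((k : 𝕜) + 1)) • e (t k)) := by
        simp [v, i, w, t]
      have hlim : Tendsto (fun k => v (t k)) atTop (𝓝 (D n)) := by
        simp only [hv]
        have h0 : Tendsto (fun k : ℕ => (1 / ((k : 𝕜) + 1)) • e (t k)) atTop (𝓝 0) := by
          refine squeeze_zero_norm (fun k => ?_)
            (tendsto_one_div_add_atTop_nhds_zero_nat (𝕜 := ℝ))
          rw [norm_smul]
          have : ‖(1 / ((k : 𝕜) + 1))‖ = 1 / ((k : ℝ) + 1) := by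
            rw [norm_div, norm_one]
            congr 1
            exact_mod_cast RCLike.norm_natCast (K := 𝕜) (k + 1)
          rw [this]
          exact mul_le_of_le_one_right (by positivity) (he _)
        simpa using ((L.continuous.tendsto 0).comp h0).const_add (D n)
      exact mem_closure_of_tendsto hlim
        (Eventually.of_forall fun k => Submodule.subset_span (mem_range_self _))
    exact dense_closure.1 (hD.mono hsub)
  · refine le_antisymm (Submodule.rank_le _) ?_
    rw [rank_span hli]
    refine (rank_le_card 𝕜 X).trans (hX.trans ?_)
    rw [Cardinal.mk_range_eq _ hli.injective, Cardinal.mk_real]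

end Lineability

/-! ### Lacunary cosine series -/

section Lacunary

variable {𝕜 : Type*} [RCLike 𝕜]

/-- The amplitude of the `n`-th derivative of `2 ^ (-α k) * cos (4 ^ (k ^ 2) * x)`. -/
noncomputable def lacunaryAmp (α : ℕ → ℕ) (n k : ℕ) : ℝ := ((4 : ℝ) ^ k ^ 2) ^ n / 2 ^ α k

/-- The termwise `n`-th derivative of the lacunary series `∑ 2 ^ (-α k) cos (4 ^ (k ^ 2) x) d k`. -/
noncomputable def lacunarySeries (α : ℕ → ℕ) (d : ℕ → 𝕜) (n : ℕ) (x : ℝ) : 𝕜 :=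
  ∑' k, (lacunaryAmp α n k * Real.cos ((4 : ℝ) ^ k ^ 2 * x + n * (Real.pi / 2))) • d k

theorem lacunaryAmp_pos (α : ℕ → ℕ) (n k : ℕ) : 0 < lacunaryAmp α n k := by
  unfold lacunaryAmp
  positivity

theorem lacunaryAmp_eq (α : ℕ → ℕ) (n k : ℕ) :
    lacunaryAmp α n k = 2 ^ (2 * n * k ^ 2) / 2 ^ α k := by
  rw [lacunaryAmp, show (4 : ℝ) = 2 ^ 2 by norm_num, ← pow_mul, ← pow_mul]
  congr 2
  ring

theorem lacunaryAmp_succ (α : ℕ → ℕ) (n k : ℕ) :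
    lacunaryAmp α (n + 1) k = lacunaryAmp α n k * (4 : ℝ) ^ k ^ 2 := by
  rw [lacunaryAmp, lacunaryAmp, pow_succ]
  ring

theorem lacunaryAmp_le_of_exponents {α : ℕ → ℕ} {n j k : ℕ}
    (h : 2 * n * j ^ 2 + α k + k + j ≤ 2 * n * k ^ 2 + α j) :
    lacunaryAmp α n j ≤ lacunaryAmp α n k * (1 / 2) ^ k * (1 / 2) ^ j := by
  rw [lacunaryAmp_eq, lacunaryAmp_eq, one_div_pow, one_div_pow, mul_one_div, mul_one_div, div_div,
    div_div, div_le_div_iff₀ (by positivity) (by positivity), ← pow_add, ← pow_add, ← pow_add,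
    ← pow_add]
  exact pow_le_pow_right₀ one_le_two (by omega)

theorem norm_lacunary_term_le (α : ℕ → ℕ) {d : ℕ → 𝕜} {C : ℝ} (hd : ∀ k, ‖d k‖ ≤ C)
    (n k : ℕ) (θ : ℝ) :
    ‖(lacunaryAmp α n k * Real.cos θ) • d k‖ ≤ lacunaryAmp α n k * C := by
  rw [norm_smul, norm_mul, Real.norm_of_nonneg (lacunaryAmp_pos α n k).le, mul_assoc]
  refine mul_le_mul_of_nonneg_left ?_ (lacunaryAmp_pos α n k).le
  exact (mul_le_of_le_one_left (norm_nonneg _) (Real.abs_cos_le_one θ)).trans (hd k)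

theorem summable_lacunary_term {α : ℕ → ℕ} {d : ℕ → 𝕜} {C : ℝ} (hd : ∀ k, ‖d k‖ ≤ C)
    {n : ℕ} (hn : Summable (lacunaryAmp α n)) (x : ℝ) :
    Summable fun k =>
      (lacunaryAmp α n k * Real.cos ((4 : ℝ) ^ k ^ 2 * x + n * (Real.pi / 2))) • d k :=
  .of_norm_bounded (hn.mul_right C) fun k => norm_lacunary_term_le α hd n k _

theorem norm_lacunarySeries_le {α : ℕ → ℕ} {d : ℕ → 𝕜} {C : ℝ} (hd : ∀ k, ‖d k‖ ≤ C)
    {n : ℕ} (hn : Summable (lacunaryAmp α n)) (x : ℝ) :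
    ‖lacunarySeries α d n x‖ ≤ (∑' k, lacunaryAmp α n k) * C :=
  tsum_of_norm_bounded (hn.hasSum.mul_right C) fun k => norm_lacunary_term_le α hd n k _

theorem continuous_lacunarySeries {α : ℕ → ℕ} {d : ℕ → 𝕜} {C : ℝ} (hd : ∀ k, ‖d k‖ ≤ C)
    {n : ℕ} (hn : Summable (lacunaryAmp α n)) : Continuous (lacunarySeries α d n) :=
  continuous_tsum (fun k => by fun_prop) (hn.mul_right C)
    fun k x => norm_lacunary_term_le α hd n k _

/-- Differentiation multiplies the amplitude by the frequency and shifts the phase by `π / 2`, so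
one formula serves all orders. -/
theorem hasDerivAt_lacunarySeries {α : ℕ → ℕ} {d : ℕ → 𝕜} {C : ℝ} (hd : ∀ k, ‖d k‖ ≤ C)
    {n : ℕ} (hn : Summable (lacunaryAmp α n)) (hn' : Summable (lacunaryAmp α (n + 1))) (x : ℝ) :
    HasDerivAt (lacunarySeries α d n) (lacunarySeries α d (n + 1) x) x := by
  refine hasDerivAt_tsum
    (g := fun k y => (lacunaryAmp α n k *
      Real.cos ((4 : ℝ) ^ k ^ 2 * y + n * (Real.pi / 2))) • d k)
    (g' := fun k y => (lacunaryAmp α (n + 1) k *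
      Real.cos ((4 : ℝ) ^ k ^ 2 * y + (n + 1 : ℕ) * (Real.pi / 2))) • d k) (hn'.mul_right C) (fun k y => ?_)
    (fun k y => norm_lacunary_term_le α hd (n + 1) k _) (summable_lacunary_term hd hn x) x
  have h1 : HasDerivAt (fun y : ℝ => (4 : ℝ) ^ k ^ 2 * y + n * (Real.pi / 2))
      ((4 : ℝ) ^ k ^ 2) y := by
    simpa using ((hasDerivAt_id y).const_mul ((4 : ℝ) ^ k ^ 2)).add_const (n * (Real.pi / 2))
  convert (h1.cos.const_mul (lacunaryAmp α n k)).smul_const (d k) using 2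
  rw [lacunaryAmp_succ, Nat.cast_succ, add_mul, one_mul, ← add_assoc, Real.cos_add_pi_div_two]
  ring

theorem iteratedDeriv_lacunarySeries {α : ℕ → ℕ} {p : ℕ∞}
    (hα : ∀ n : ℕ, (n : ℕ∞) ≤ p → Summable (lacunaryAmp α n))
    {d : ℕ → 𝕜} {C : ℝ} (hd : ∀ k, ‖d k‖ ≤ C) {n : ℕ} (hn : (n : ℕ∞) ≤ p) :
    iteratedDeriv n (lacunarySeries α d 0) = lacunarySeries α d n := by
  induction n with
  | zero => exact iteratedDeriv_zero
  | succ n ih =>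
    have hn' : (n : ℕ∞) ≤ p := le_trans (by exact_mod_cast n.le_succ) hn
    rw [iteratedDeriv_succ, ih hn']
    exact funext fun x => (hasDerivAt_lacunarySeries hd (hα n hn') (hα _ hn) x).deriv

theorem contDiff_lacunarySeries {α : ℕ → ℕ} {p : ℕ∞}
    (hα : ∀ n : ℕ, (n : ℕ∞) ≤ p → Summable (lacunaryAmp α n))
    {d : ℕ → 𝕜} {C : ℝ} (hd : ∀ k, ‖d k‖ ≤ C) : ContDiff ℝ p (lacunarySeries α d 0) := by
  refine contDiff_iff_iteratedDeriv.2 ⟨fun m hm => ?_, fun m hm => ?_⟩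
  · rw [iteratedDeriv_lacunarySeries hα hd hm]
    exact continuous_lacunarySeries hd (hα m hm)
  · have hm' : ((m + 1 : ℕ) : ℕ∞) ≤ p := by
      simpa using Order.add_one_le_of_lt hm
    rw [iteratedDeriv_lacunarySeries hα hd hm.le]
    exact fun x => (hasDerivAt_lacunarySeries hd (hα m hm.le) (hα _ hm') x).differentiableAt

/-- The operator that maps a bounded sequence to the sum of the lacunary series with these
coefficients. -/
noncomputable def lacunaryCLM (𝕜 : Type*) [RCLike 𝕜] (α : ℕ → ℕ) (p : ℕ∞)
    (hα : ∀ n : ℕ, (n : ℕ∞) ≤ p → Summable (lacunaryAmp α n)) :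
    lp (fun _ : ℕ => 𝕜) ⊤ →L[𝕜] CpSpace 𝕜 p :=
  let T : lp (fun _ : ℕ => 𝕜) ⊤ →ₗ[𝕜] CpSpace 𝕜 p :=
    { toFun := fun d => CpSpace.ofContDiff (lacunarySeries α d 0)
        (contDiff_lacunarySeries hα fun k => lp.norm_apply_le_norm ENNReal.top_ne_zero d k)
      map_add' := fun d e => Subtype.ext <| funext fun x => by
        have h (d : lp (fun _ : ℕ => 𝕜) ⊤) := summable_lacunary_term
          (fun k => lp.norm_apply_le_norm ENNReal.top_ne_zero d k) (hα 0 zero_le) x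
        refine Eq.trans ?_ ((h d).tsum_add (h e))
        exact tsum_congr fun k => smul_add _ _ _
      map_smul' := fun c d => Subtype.ext <| funext fun x => by
        refine Eq.trans ?_ (tsum_const_smul'' c)
        exact tsum_congr fun k => smul_comm _ c (d k) }
  -- Continuity is checked on each derivative, whose sup norm is at most the sum of the amplitudes
  -- times `‖d‖`.
  ⟨T, CpSpace.continuous_iff.2 fun n hn =>
    AddMonoidHomClass.continuous_of_bound ((CpSpace.derivLM n hn).comp T)
      (∑' k, lacunaryAmp α n k) fun d => by
        have hd : ∀ k, ‖d k‖ ≤ ‖d‖ := fun k => lp.norm_apply_le_norm ENNReal.top_ne_zero d k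
        rw [ContinuousMap.norm_le _
          (mul_nonneg (tsum_nonneg fun k => (lacunaryAmp_pos α n k).le) (norm_nonneg d))]
        intro x
        refine le_trans (le_of_eq (congrArg _ ?_)) (norm_lacunarySeries_le hd (hα n hn) x)
        rw [← iteratedDeriv_lacunarySeries hα hd hn]
        exact CpSpace.der_ofContDiff (contDiff_lacunarySeries hα hd) hn x.2⟩

theorem der_lacunaryCLM {α : ℕ → ℕ} {p : ℕ∞}
    (hα : ∀ n : ℕ, (n : ℕ∞) ≤ p → Summable (lacunaryAmp α n)) (d : lp (fun _ : ℕ => 𝕜) ⊤)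
    {n : ℕ} (hn : (n : ℕ∞) ≤ p) {x : ℝ} (hx : x ∈ Icc (0 : ℝ) 1) :
    (lacunaryCLM 𝕜 α p hα d).der n x = lacunarySeries α d n x := by
  have hd : ∀ k, ‖d k‖ ≤ ‖d‖ := fun k => lp.norm_apply_le_norm ENNReal.top_ne_zero d k
  rw [← iteratedDeriv_lacunarySeries hα hd hn]
  exact CpSpace.der_ofContDiff (contDiff_lacunarySeries hα hd) hn hx

/-- The factors `(1 / 2) ^ j` sum to `2`; the extra `(1 / 2) ^ k` makes the total of the other terms
negligible against `s k` as `k` grows. -/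
theorem norm_sub_le_norm_tsum_of_dominant {s : ℕ → ℝ} {e : ℕ → 𝕜} {C : ℝ} (hC : 0 ≤ C) {k : ℕ}
    (hk : 0 ≤ s k) (hs : ∀ j, j ≠ k → s j ≤ s k * (1 / 2) ^ k * (1 / 2) ^ j)
    (he : ∀ j, ‖e j‖ ≤ C * s j) :
    ‖e k‖ - 2 * C * (1 / 2) ^ k * s k ≤ ‖∑' j, e j‖ := by
  have hsum : HasSum (fun j : ℕ => C * (s k * (1 / 2) ^ k) * (1 / 2 : ℝ) ^ j)
      (C * (s k * (1 / 2) ^ k) * 2) := hasSum_geometric_two.mul_left _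
  have hb (j : ℕ) : ‖if j = k then 0 else e j‖ ≤ C * (s k * (1 / 2) ^ k) * (1 / 2 : ℝ) ^ j := by
    split_ifs with h
    · rw [norm_zero]
      positivity
    · rw [mul_assoc]
      exact (he j).trans (mul_le_mul_of_nonneg_left (hs j h) hC)
  have hes : Summable e := by
    refine Summable.of_norm_bounded_eventually_nat hsum.summable ?_
    filter_upwards [eventually_gt_atTop k] with j hj
    simpa [hj.ne'] using hb j
  rw [hes.tsum_eq_add_tsum_ite k]
  have h1 := tsum_of_norm_bounded hsum hb
  have h2 := norm_sub_le_norm_add (e k) (∑' j, if j = k then 0 else e j)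
  linarith

theorem exists_frequently_le_norm {d : ℕ → 𝕜} (h : ¬ Tendsto d atTop (𝓝 0)) :
    ∃ δ > 0, ∃ᶠ k in atTop, δ ≤ ‖d k‖ := by
  rw [Metric.tendsto_nhds] at h
  push Not at h
  obtain ⟨δ, hδ, h⟩ := h
  exact ⟨δ, hδ, h.mono fun k hk => by simpa using hk⟩

end Lacunary

/-! ### Derivatives growing like `(n!)²` at every point -/

section Pringsheim

variable {𝕜 : Type*} [RCLike 𝕜]

theorem summable_lacunaryAmp_cube (n : ℕ) : Summable (lacunaryAmp (fun k => 4 * k ^ 3) n) := by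
  refine Summable.of_norm_bounded_eventually_nat summable_geometric_two ?_
  filter_upwards [eventually_ge_atTop n] with k hk
  rw [Real.norm_of_nonneg (lacunaryAmp_pos _ n k).le, lacunaryAmp_eq, one_div_pow,
    div_le_div_iff₀ (by positivity) (by positivity), one_mul, ← pow_add]
  refine pow_le_pow_right₀ one_le_two ?_
  have h1 : n * k ^ 2 ≤ k ^ 3 := by
    rw [pow_succ' k 2]
    exact Nat.mul_le_mul_right _ hk
  have h2 : k ≤ k ^ 3 := Nat.le_self_pow three_ne_zero k
  nlinarith

/-- The amplitude is `2 ^ (2 n j² - 4 j³)`, whose exponent, for real `j > 0`, is largest at `j = n /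
3`. -/
theorem lacunaryAmp_cube_le {n j k : ℕ} (hn : n = 3 * k ∨ n = 3 * k + 1) (hj : j ≠ k) :
    lacunaryAmp (fun k => 4 * k ^ 3) n j
      ≤ lacunaryAmp (fun k => 4 * k ^ 3) n k * (1 / 2) ^ k * (1 / 2) ^ j := by
  refine lacunaryAmp_le_of_exponents ?_
  rcases lt_or_gt_of_ne hj with h | h
  · obtain ⟨m, rfl⟩ := Nat.exists_eq_add_of_lt h
    rcases hn with rfl | rfl <;> ring_nf <;> nlinarith [Nat.zero_le (j * m), Nat.zero_le (m ^ 2)]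
  · obtain ⟨m, rfl⟩ := Nat.exists_eq_add_of_lt h
    rcases hn with rfl | rfl <;> ring_nf <;> nlinarith [Nat.zero_le (k * m), Nat.zero_le (m ^ 2)]

theorem factorial_sq_mul_le_lacunaryAmp {n k : ℕ} (hn : n = 3 * k ∨ n = 3 * k + 1) (hk : 9 ≤ k) :
    ((n ! : ℝ)) ^ 2 * 2 ^ k ≤ lacunaryAmp (fun k => 4 * k ^ 3) n k := by
  have h1 : n ! ≤ 2 ^ (2 * k * (3 * k + 1)) := by
    have h4 : ∀ k : ℕ, 3 * k + 1 ≤ 4 ^ k := fun k => by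
      induction k with
      | zero => simp
      | succ k ih => rw [pow_succ]; omega
    calc n ! ≤ n ^ n := Nat.factorial_le_pow n
      _ ≤ (3 * k + 1) ^ (3 * k + 1) := (Nat.pow_le_pow_left (by omega) n).trans (Nat.pow_le_pow_right (by omega) (by omega))
      _ ≤ (4 ^ k) ^ (3 * k + 1) := Nat.pow_le_pow_left (h4 k) _
      _ = 2 ^ (2 * k * (3 * k + 1)) := by
        rw [show 4 = 2 ^ 2 by norm_num, ← pow_mul, ← pow_mul, mul_assoc 2]
  have h2 : (n ! : ℝ) ≤ 2 ^ (2 * k * (3 * k + 1)) := by exact_mod_cast h1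
  rw [lacunaryAmp_eq, le_div_iff₀ (by positivity)]
  calc (n ! : ℝ) ^ 2 * 2 ^ k * 2 ^ (4 * k ^ 3)
      ≤ (2 ^ (2 * k * (3 * k + 1))) ^ 2 * 2 ^ k * 2 ^ (4 * k ^ 3) := by gcongr
    _ = 2 ^ (2 * k * (3 * k + 1) * 2 + k + 4 * k ^ 3) := by rw [← pow_mul, ← pow_add, ← pow_add]
    _ ≤ 2 ^ (2 * n * k ^ 2) := by
      refine pow_le_pow_right₀ one_le_two ?_
      have h3 : 3 * k * k ^ 2 ≤ n * k ^ 2 := Nat.mul_le_mul_right _ (by omega)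
      -- It suffices that `12 k² + 5 k ≤ 2 k³`, which `k ≥ 9` ensures.
      nlinarith [Nat.mul_le_mul_right (k ^ 2) hk, Nat.mul_le_mul_right k hk]

theorem frequently_factorial_sq_le_norm_lacunarySeries {d : ℕ → 𝕜} {C : ℝ} (hd : ∀ k, ‖d k‖ ≤ C)
    (hd0 : ¬ Tendsto d atTop (𝓝 0)) (x : ℝ) :
    ∃ᶠ n in atTop, ((n ! : ℝ)) ^ 2 ≤ ‖lacunarySeries (fun k => 4 * k ^ 3) d n x‖ := by
  obtain ⟨δ, hδ, hfreq⟩ := exists_frequently_le_norm hd0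
  have hC : 0 ≤ C := (norm_nonneg _).trans (hd 0)
  have hpow : Tendsto (fun k : ℕ => (1 / 2 : ℝ) ^ k) atTop (𝓝 0) :=
    tendsto_pow_atTop_nhds_zero_of_lt_one (by norm_num) (by norm_num)
  have h1 : ∀ᶠ k : ℕ in atTop, 2 * C * (1 / 2 : ℝ) ^ k < δ / 4 := by
    have := hpow.const_mul (2 * C)
    rw [mul_zero] at this
    exact this.eventually_lt_const (by positivity)
  have h2 : ∀ᶠ k : ℕ in atTop, (1 / 2 : ℝ) ^ k < δ / 4 :=
    hpow.eventually_lt_const (by positivity)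
  refine frequently_atTop.2 fun N => ?_
  obtain ⟨k, hdk, hk1, hk2, hk9, hkN⟩ := (hfreq.and_eventually
    (h1.and (h2.and ((eventually_ge_atTop 9).and (eventually_ge_atTop N))))).exists
  -- At consecutive orders the cosine becomes, up to sign, the sine of the same angle; both cannot
  -- be below `1 / 2` in absolute value.
  obtain ⟨n, hn, hcos⟩ : ∃ n, (n = 3 * k ∨ n = 3 * k + 1) ∧
      1 / 2 ≤ |Real.cos ((4 : ℝ) ^ k ^ 2 * x + n * (Real.pi / 2))| := by
    by_contra! h
    have a := h _ (Or.inl rfl)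
    have b := h _ (Or.inr rfl)
    rw [Nat.cast_succ, add_mul, one_mul, ← add_assoc, Real.cos_add_pi_div_two, abs_neg] at b
    have := Real.sin_sq_add_cos_sq ((4 : ℝ) ^ k ^ 2 * x + (3 * k : ℕ) * (Real.pi / 2))
    rw [← sq_abs, ← sq_abs (Real.cos _)] at this
    nlinarith [abs_nonneg (Real.sin ((4 : ℝ) ^ k ^ 2 * x + (3 * k : ℕ) * (Real.pi / 2))),
      abs_nonneg (Real.cos ((4 : ℝ) ^ k ^ 2 * x + (3 * k : ℕ) * (Real.pi / 2)))]
  refine ⟨n, by omega, ?_⟩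
  set s := lacunaryAmp (fun k => 4 * k ^ 3) n
  have hs : 0 < s k := lacunaryAmp_pos _ n k
  have key := norm_sub_le_norm_tsum_of_dominant hC hs.le
    (fun j hj => lacunaryAmp_cube_le hn hj)
    (fun j => (norm_lacunary_term_le (fun k => 4 * k ^ 3) hd n j
      ((4 : ℝ) ^ j ^ 2 * x + n * (Real.pi / 2))).trans_eq (mul_comm _ _))
  have hek : δ / 2 * s k ≤
      ‖(s k * Real.cos ((4 : ℝ) ^ k ^ 2 * x + n * (Real.pi / 2))) • d k‖ := by
    rw [norm_smul, norm_mul, Real.norm_of_nonneg hs.le, Real.norm_eq_abs]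
    nlinarith [mul_le_mul hcos hdk hδ.le (abs_nonneg _)]
  have hfac : (n ! : ℝ) ^ 2 * 2 ^ k ≤ s k := factorial_sq_mul_le_lacunaryAmp hn hk9
  have h3 : (n ! : ℝ) ^ 2 ≤ (1 / 2) ^ k * s k := by
    rw [one_div_pow, one_div_mul_eq_div, le_div_iff₀ (by positivity)]
    exact hfac
  have h4 := mul_le_mul_of_nonneg_right hk1.le hs.le
  have h5 := mul_le_mul_of_nonneg_right hk2.le hs.le
  refine le_trans ?_ key
  change _ ≤ ‖(s k * Real.cos ((4 : ℝ) ^ k ^ 2 * x + n * (Real.pi / 2))) • d k‖ - _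
  linarith

end Pringsheim

/-! ### A nowhere differentiable `p`-th derivative -/

section NowhereDifferentiable

variable {𝕜 : Type*} [RCLike 𝕜]

theorem lacunaryAmp_sq (p k : ℕ) :
    lacunaryAmp (fun k => k ^ 2 + 2 * p * k ^ 2) p k = (1 / 2) ^ k ^ 2 := by
  rw [lacunaryAmp_eq, pow_add, one_div_pow]
  field_simp

theorem summable_lacunaryAmp_sq {p n : ℕ} (hn : n ≤ p) :
    Summable (lacunaryAmp (fun k => k ^ 2 + 2 * p * k ^ 2) n) := by
  refine Summable.of_nonneg_of_le (fun k => (lacunaryAmp_pos _ n k).le) (fun k => ?_)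
    summable_geometric_two
  rw [lacunaryAmp_eq, one_div_pow, div_le_div_iff₀ (by positivity) (by positivity), one_mul,
    ← pow_add]
  refine pow_le_pow_right₀ one_le_two ?_
  have h1 : n * k ^ 2 ≤ p * k ^ 2 := Nat.mul_le_mul_right _ hn
  have h2 : k ≤ k ^ 2 := Nat.le_self_pow two_ne_zero k
  nlinarith

/-- The minimum bounds, up to a factor `4`, the change of the `j`-th cosine over a distance `4 / 4 ^
k ^ 2`. For `j < k` the Lipschitz bound wins, for `j > k` the small amplitude; both rest on `|k² -
j²| ≥ k + j`. -/
theorem lacunaryAmp_sq_mul_min_le (p : ℕ) {j k : ℕ} (hj : j ≠ k) :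
    lacunaryAmp (fun k => k ^ 2 + 2 * p * k ^ 2) p j * min 1 ((4 : ℝ) ^ j ^ 2 / 4 ^ k ^ 2) ≤
      lacunaryAmp (fun k => k ^ 2 + 2 * p * k ^ 2) p k * (1 / 2) ^ k * (1 / 2) ^ j := by
  rcases lt_or_gt_of_ne hj with h | h
  · refine (mul_le_mul_of_nonneg_left (min_le_right _ _) (lacunaryAmp_pos _ p j).le).trans ?_
    rw [← mul_div_assoc, ← lacunaryAmp_succ, div_le_iff₀ (by positivity)]
    refine (lacunaryAmp_le_of_exponents (k := k) ?_).trans_eq ?_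
    · have h1 : j ^ 2 + k + j ≤ k ^ 2 := by nlinarith
      ring_nf
      nlinarith
    · rw [lacunaryAmp_succ]
      ring
  · refine (mul_le_of_le_one_right (lacunaryAmp_pos _ p j).le (min_le_left _ _)).trans ?_
    refine lacunaryAmp_le_of_exponents ?_
    have h1 : k ^ 2 + k + j ≤ j ^ 2 := by nlinarith
    ring_nf
    nlinarith

/-- Move a half or a quarter period towards the farther endpoint; `b ≥ 8` keeps this inside `[0,1]`.
If both changes were below `1 / 2`, the first would give `|cos| < 1 / 4`, the second then `|sin| < 3
/ 4`, contradicting `sin² + cos² = 1`. -/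
theorem exists_mem_Icc_half_le_abs_cos_sub {b : ℝ} (hb : 8 ≤ b) (θ : ℝ) {x : ℝ}
    (hx : x ∈ Icc (0 : ℝ) 1) : ∃ y ∈ Icc (0 : ℝ) 1, |y - x| ≤ 4 / b ∧
      1 / 2 ≤ |Real.cos (b * y + θ) - Real.cos (b * x + θ)| := by
  have hb0 : 0 < b := by linarith
  have hpi : Real.pi / b ≤ 1 / 2 := by
    rw [div_le_iff₀ hb0]
    linarith [Real.pi_le_four]
  have hpi' : Real.pi / b ≤ 4 / b := div_le_div_of_nonneg_right Real.pi_le_four hb0.le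
  have hpos : 0 < Real.pi / b := div_pos Real.pi_pos hb0
  obtain ⟨σ, hσ, hmem⟩ : ∃ σ : ℝ, (σ = 1 ∨ σ = -1) ∧
      ∀ h, 0 ≤ h → h ≤ 1 / 2 → x + σ * h ∈ Icc (0 : ℝ) 1 := by
    obtain ⟨h0, h1⟩ := hx
    rcases le_total x (1 / 2) with h | h
    · exact ⟨1, Or.inl rfl, fun t ht ht' => ⟨by linarith, by linarith⟩⟩
    · exact ⟨-1, Or.inr rfl, fun t ht ht' => ⟨by linarith, by linarith⟩⟩
  have habs (t : ℝ) (ht : 0 ≤ t) : |x + σ * t - x| = t := by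
    rw [add_sub_cancel_left, abs_mul, abs_of_nonneg ht]
    rcases hσ with rfl | rfl <;> simp
  have hcos1 : Real.cos (b * (x + σ * (Real.pi / b)) + θ) = -Real.cos (b * x + θ) := by
    rw [show b * (x + σ * (Real.pi / b)) + θ = b * x + θ + σ * Real.pi by field_simp; ring]
    rcases hσ with rfl | rfl
    · rw [one_mul, Real.cos_add_pi]
    · rw [neg_one_mul, ← sub_eq_add_neg, Real.cos_sub_pi]
  have hcos2 : Real.cos (b * (x + σ * (Real.pi / b / 2)) + θ) = -(σ * Real.sin (b * x + θ)) := by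
    rw [show b * (x + σ * (Real.pi / b / 2)) + θ = b * x + θ + σ * (Real.pi / 2) by
      field_simp; ring]
    rcases hσ with rfl | rfl
    · rw [one_mul, one_mul, Real.cos_add_pi_div_two]
    · rw [neg_one_mul, neg_one_mul, neg_neg, ← sub_eq_add_neg, Real.cos_sub_pi_div_two]
  by_contra! hcon
  have h1 := hcon _ (hmem _ hpos.le hpi) (by rwa [habs _ hpos.le])
  have h2 := hcon _ (hmem (Real.pi / b / 2) (by positivity) (by linarith))
    (by rw [habs _ (by positivity)]; linarith)
  rw [hcos1, abs_lt] at h1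
  rw [hcos2, abs_lt] at h2
  have hσ2 : σ ^ 2 = 1 := by rcases hσ with rfl | rfl <;> norm_num
  have hsc : (σ * Real.sin (b * x + θ)) ^ 2 + Real.cos (b * x + θ) ^ 2 = 1 := by
    rw [mul_pow, hσ2, one_mul, Real.sin_sq_add_cos_sq]
  have hc : Real.cos (b * x + θ) ^ 2 < 1 / 16 := by
    nlinarith
  have hs : (σ * Real.sin (b * x + θ)) ^ 2 < 9 / 16 := by
    have := abs_lt_of_sq_lt_sq (a := Real.cos (b * x + θ)) (b := 1 / 4) (by linarith) (by norm_num)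
    rw [abs_lt] at this
    nlinarith
  linarith

theorem abs_cos_sub_le_four_mul_min {b B x y θ : ℝ} (hb : 0 < b) (hy : |y - x| ≤ 4 / B) :
    |Real.cos (b * y + θ) - Real.cos (b * x + θ)| ≤ 4 * min 1 (b / B) := by
  rw [mul_min_of_nonneg _ _ (by norm_num : (0 : ℝ) ≤ 4)]
  refine le_min ?_ ?_
  · refine (abs_sub _ _).trans ?_
    linarith [Real.abs_cos_le_one (b * y + θ), Real.abs_cos_le_one (b * x + θ)]
  · have h := Real.lipschitzWith_cos.dist_le_mul (b * y + θ) (b * x + θ)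
    rw [Real.dist_eq, Real.dist_eq, NNReal.coe_one, one_mul, add_sub_add_right_eq_sub, ← mul_sub,
      abs_mul, abs_of_pos hb] at h
    refine h.trans ((mul_le_mul_of_nonneg_left hy hb.le).trans_eq ?_)
    ring

theorem not_differentiableWithinAt_lacunarySeries (p : ℕ) {d : ℕ → 𝕜} {C : ℝ}
    (hd : ∀ k, ‖d k‖ ≤ C) (hd0 : ¬ Tendsto d atTop (𝓝 0)) {x : ℝ} (hx : x ∈ Icc (0 : ℝ) 1) :
    ¬ DifferentiableWithinAt ℝ (lacunarySeries (fun k => k ^ 2 + 2 * p * k ^ 2) d p)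
      (Icc 0 1) x := by
  intro hdiff
  obtain ⟨δ, hδ, hfreq⟩ := exists_frequently_le_norm hd0
  have hC : 0 ≤ C := (norm_nonneg _).trans (hd 0)
  -- Only this consequence of differentiability is refuted: increments from `x` are at most `K |y -
  -- x|` nearby.
  obtain ⟨K, hK, hbound⟩ := hdiff.isBigO_sub.exists_pos
  rw [Asymptotics.IsBigOWith, eventually_nhdsWithin_iff, Metric.eventually_nhds_iff] at hbound
  obtain ⟨r, hr, hbound⟩ := hbound
  have hpow : Tendsto (fun k : ℕ => (1 / 2 : ℝ) ^ k) atTop (𝓝 0) :=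
    tendsto_pow_atTop_nhds_zero_of_lt_one (by norm_num) (by norm_num)
  have hsq : Tendsto (fun k : ℕ => k ^ 2) atTop atTop := tendsto_pow_atTop two_ne_zero
  have hfour : Tendsto (fun k : ℕ => (4 : ℝ) ^ k ^ 2) atTop atTop :=
    (tendsto_pow_atTop_atTop_of_one_lt (by norm_num : (1 : ℝ) < 4)).comp hsq
  have h1 : ∀ᶠ k : ℕ in atTop, 8 * C * (1 / 2 : ℝ) ^ k < δ / 4 := by
    have := hpow.const_mul (8 * C)
    rw [mul_zero] at this
    exact this.eventually_lt_const (by positivity)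
  have h2 : ∀ᶠ k : ℕ in atTop, 4 * K * (1 / 2 : ℝ) ^ k ^ 2 < δ / 4 := by
    have := (hpow.comp hsq).const_mul (4 * K)
    rw [mul_zero] at this
    exact this.eventually_lt_const (by positivity)
  have h3 : ∀ᶠ k : ℕ in atTop, 4 / (4 : ℝ) ^ k ^ 2 < r :=
    (hfour.const_div_atTop 4).eventually_lt_const hr
  obtain ⟨k, hdk, hk1, hk2, hk3, hk4⟩ := (hfreq.and_eventually
    (h1.and (h2.and (h3.and (hfour.eventually_ge_atTop 8))))).exists
  obtain ⟨y, hy, hyx, hcos⟩ := exists_mem_Icc_half_le_abs_cos_sub hk4 (p * (Real.pi / 2)) hx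
  have hle := hbound (y := y) (by rw [Real.dist_eq]; linarith) hy
  set s := lacunaryAmp (fun k => k ^ 2 + 2 * p * k ^ 2) p with hs_def
  have hs (j : ℕ) : 0 < s j := lacunaryAmp_pos _ p j
  let e : ℕ → 𝕜 := fun j => (s j * (Real.cos ((4 : ℝ) ^ j ^ 2 * y + p * (Real.pi / 2)) -
    Real.cos ((4 : ℝ) ^ j ^ 2 * x + p * (Real.pi / 2)))) • d j
  have hnorm (j : ℕ) : ‖e j‖ = s j * |Real.cos ((4 : ℝ) ^ j ^ 2 * y + p * (Real.pi / 2)) -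
      Real.cos ((4 : ℝ) ^ j ^ 2 * x + p * (Real.pi / 2))| * ‖d j‖ := by
    rw [norm_smul, norm_mul, Real.norm_of_nonneg (hs j).le, Real.norm_eq_abs]
  have hmin : min 1 ((4 : ℝ) ^ k ^ 2 / 4 ^ k ^ 2) = 1 := by
    rw [div_self (by positivity), min_self]
  have key := norm_sub_le_norm_tsum_of_dominant (e := e) (C := 4 * C) (k := k)
    (s := fun j => s j * min 1 ((4 : ℝ) ^ j ^ 2 / 4 ^ k ^ 2)) (by positivity)
    (mul_nonneg (hs k).le (by positivity))
    (fun j hj => by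
      simp only [hmin, mul_one]
      exact lacunaryAmp_sq_mul_min_le p hj)
    (fun j => by
      rw [hnorm]
      have h5 := abs_cos_sub_le_four_mul_min (b := (4 : ℝ) ^ j ^ 2) (θ := p * (Real.pi / 2))
        (by positivity) hyx
      calc _ ≤ s j * (4 * min 1 ((4 : ℝ) ^ j ^ 2 / 4 ^ k ^ 2)) * C := by
            refine mul_le_mul (mul_le_mul_of_nonneg_left h5 (hs j).le) (hd j) (norm_nonneg _) ?_
            exact mul_nonneg (hs j).le (by positivity)
        _ = _ := by ring)
  have hsum : ∑' j, e j = lacunarySeries (fun k => k ^ 2 + 2 * p * k ^ 2) d p y -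
      lacunarySeries (fun k => k ^ 2 + 2 * p * k ^ 2) d p x := by
    have hsm := summable_lacunaryAmp_sq (le_refl p)
    rw [lacunarySeries, lacunarySeries,
      ← (summable_lacunary_term hd hsm y).tsum_sub (summable_lacunary_term hd hsm x)]
    refine tsum_congr fun j => ?_
    rw [← sub_smul, ← mul_sub]
  simp only [hsum, hmin, mul_one] at key
  have hek : δ / 2 * s k ≤ ‖e k‖ := by
    rw [hnorm]
    have := mul_le_mul hcos hdk hδ.le (abs_nonneg _)
    nlinarith [mul_le_mul_of_nonneg_left this (hs k).le]
  -- Since `s k = 2 ^ (-k ^ 2)`, the step length `4 / 4 ^ k ^ 2` is negligible against `s k`.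
  have hfin : ‖y - x‖ * K ≤ 4 * K * (1 / 2) ^ k ^ 2 * s k := by
    have e1 : (1 / 2 : ℝ) ^ k ^ 2 * s k = 1 / 4 ^ k ^ 2 := by
      rw [hs_def, lacunaryAmp_sq, ← mul_pow, ← one_div_pow]
      norm_num
    calc ‖y - x‖ * K ≤ 4 / 4 ^ k ^ 2 * K := mul_le_mul_of_nonneg_right hyx hK.le
      _ = 4 * K * ((1 / 2) ^ k ^ 2 * s k) := by rw [e1]; ring
      _ = _ := by ring
  have h4 := mul_lt_mul_of_pos_right hk1 (hs k)
  have h5 := mul_lt_mul_of_pos_right hk2 (hs k)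
  linarith

end NowhereDifferentiable

/-! ### Consequences of factorial growth -/

section Growth

variable {𝕜 : Type*} [RCLike 𝕜]

theorem not_frequently_factorial_sq_le {u : ℕ → ℝ} {C r : ℝ}
    (hu : ∀ n, u n ≤ n ! * (C * r ^ n)) : ¬ ∃ᶠ n in atTop, ((n ! : ℝ)) ^ 2 ≤ u n := by
  have h := (FloorSemiring.tendsto_pow_div_factorial_atTop r).const_mul C
  rw [mul_zero] at h
  rw [not_frequently]
  filter_upwards [h.eventually_lt_const one_pos] with n hn hle
  have hpos : (0 : ℝ) < n ! := by exact_mod_cast n.factorial_pos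
  rw [← mul_div_assoc, div_lt_one hpos] at hn
  have h1 := hle.trans (hu n)
  rw [sq] at h1
  exact absurd (le_of_mul_le_mul_left h1 hpos) (not_le.2 hn)

theorem CpSpace.hasPringsheimSingularityAt_of_frequently {f : CpSpace 𝕜 ⊤} {x : ℝ}
    (h : ∃ᶠ n in atTop, ((n ! : ℝ)) ^ 2 ≤ ‖f.der n x‖) : f.HasPringsheimSingularityAt x := by
  by_contra hr
  obtain ⟨C, r, hC, hr, hb⟩ := (f.taylorAt x).le_mul_pow_of_radius_pos (pos_iff_ne_zero.2 hr)
  refine not_frequently_factorial_sq_le (C := C) (r := r) (fun n => ?_) h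
  have h1 := hb n
  rw [taylorAt, FormalMultilinearSeries.ofScalars_norm, norm_div, RCLike.norm_natCast,
    div_le_iff₀' (by exact_mod_cast n.factorial_pos)] at h1
  exact h1

theorem CpSpace.not_isAnalyticAt_of_frequently {f : CpSpace 𝕜 ⊤} {x : ℝ}
    (hx : x ∈ Icc (0 : ℝ) 1) (h : ∃ᶠ n in atTop, ((n ! : ℝ)) ^ 2 ≤ ‖f.der n x‖) :
    ¬ f.IsAnalyticAt x := by
  intro ha
  -- `g` is analytic on both sides of `x` and agrees with `f` on all of `[0,1]`, so one-sided
  -- derivatives at an endpoint become ordinary ones.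
  obtain ⟨g, -, hfg, hg⟩ := AnalyticWithinAt.exists_analyticAt ha
  have ⟨q, _, hq⟩ := hg
  obtain ⟨C, r, hC, hr, hb⟩ := q.le_mul_pow_of_radius_pos hq.radius_pos
  refine not_frequently_factorial_sq_le (C := C) (r := r) (fun n => ?_) h
  have hder : f.der n x = iteratedDeriv n g x :=
    CpSpace.der_eq_of_eqOn hg.contDiffAt (hfg.mono (subset_insert _ _)) hx
  have hcoeff : iteratedDeriv n g x = (n ! : ℝ) • q n fun _ => 1 := by
    rw [iteratedDeriv_eq_iteratedFDeriv, ← hq.factorial_smul, Nat.cast_smul_eq_nsmul]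
  rw [hder, hcoeff, norm_smul, Real.norm_natCast]
  refine mul_le_mul_of_nonneg_left (le_trans ?_ (hb n)) (Nat.cast_nonneg _)
  exact ((q n).le_opNorm fun _ => (1 : ℝ)).trans_eq (by simp)

end Growth

/-! ### Assembly -/

section Main

theorem CpSpace.maximalDenseLineable_of_polynomial_add {𝕜 : Type} [RCLike 𝕜] {p : ℕ∞}
    {A : Set (CpSpace 𝕜 p)} (hA0 : (0 : CpSpace 𝕜 p) ∉ A)
    (L : lp (fun _ : ℕ => 𝕜) ⊤ →L[𝕜] CpSpace 𝕜 p)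
    (hA : ∀ P : 𝕜[X], ∀ d : lp (fun _ : ℕ => 𝕜) ⊤, ¬ Tendsto (fun k => d k) atTop (𝓝 0) →
      polyLM 𝕜 p P + L d ∈ A) : MaximalDenseLineable 𝕜 A := by
  have hspan : Submodule.span 𝕜 (range fun n : ℕ => polyLM 𝕜 p (X ^ n)) =
      LinearMap.range (polyLM 𝕜 p) := by
    rw [LinearMap.range_eq_map, ← (Polynomial.basisMonomials 𝕜).span_eq, Submodule.map_span,
      ← range_comp]
    simp [Function.comp_def, Polynomial.monomial_one_right_eq_X_pow]
  refine maximalDenseLineable_of_bounded_sequences (mk_le_continuum 𝕜 p) hA0 L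
    (fun n => polyLM 𝕜 p (X ^ n)) ?_ ?_
  · rw [hspan]
    exact denseRange_polyLM 𝕜 p
  · rw [hspan]
    rintro _ ⟨P, rfl⟩ d hd
    exact hA P d hd

theorem CpSpace.maximalDenseLineable_nowhere_differentiable (𝕜 : Type) [RCLike 𝕜] (p : ℕ) :
    MaximalDenseLineable 𝕜 {f : CpSpace 𝕜 (p : ℕ∞) |
      ∀ x ∈ Icc (0 : ℝ) 1, ¬ DifferentiableWithinAt ℝ (f.der p) (Icc 0 1) x} := by
  have h0 : (0 : ℝ) ∈ Icc (0 : ℝ) 1 := left_mem_Icc.2 zero_le_one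
  have hα (n : ℕ) (hn : (n : ℕ∞) ≤ (p : ℕ∞)) := summable_lacunaryAmp_sq (p := p)
    (Nat.cast_le.1 hn)
  refine maximalDenseLineable_of_polynomial_add (fun h => h 0 h0 ?_)
    (lacunaryCLM 𝕜 _ p hα) fun P d hd x hx hdiff => ?_
  · exact (differentiableWithinAt_const (0 : 𝕜)).congr
      (fun x hx => der_zero_elem le_rfl hx) (der_zero_elem le_rfl h0)
  · refine not_differentiableWithinAt_lacunarySeries p
      (fun k => lp.norm_apply_le_norm ENNReal.top_ne_zero d k) hd hx ?_
    -- The polynomial part is differentiable and can be subtracted.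
    have heq (y : ℝ) (hy : y ∈ Icc (0 : ℝ) 1) :
        lacunarySeries (fun k => k ^ 2 + 2 * p * k ^ 2) d p y =
          (polyLM 𝕜 p P + lacunaryCLM 𝕜 _ p hα d).der p y -
            polyFun (derivative^[p] P) y := by
      rw [der_add le_rfl _ _ hy, der_polyLM P le_rfl hy, der_lacunaryCLM hα d le_rfl hy,
        add_sub_cancel_left]
    exact (hdiff.sub (hasDerivAt_polyFun _ x).differentiableAt.differentiableWithinAt).congr
      heq (heq x hx)

theorem CpSpace.maximalDenseLineable_factorial_growth (𝕜 : Type) [RCLike 𝕜] :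
    MaximalDenseLineable 𝕜 {f : CpSpace 𝕜 (⊤ : ℕ∞) |
      ∀ x ∈ Icc (0 : ℝ) 1, ∃ᶠ n in atTop, ((n ! : ℝ)) ^ 2 ≤ ‖f.der n x‖} := by
  have h0 : (0 : ℝ) ∈ Icc (0 : ℝ) 1 := left_mem_Icc.2 zero_le_one
  refine maximalDenseLineable_of_polynomial_add (fun h => ?_)
    (lacunaryCLM 𝕜 _ ⊤ fun n _ => summable_lacunaryAmp_cube n) fun P d hd x hx => ?_
  · obtain ⟨n, hn⟩ := (h 0 h0).exists
    rw [der_zero_elem le_top h0, norm_zero] at hn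
    have : (0 : ℝ) < n ! := by exact_mod_cast n.factorial_pos
    exact absurd hn (not_le.2 (by positivity))
  · refine ((frequently_factorial_sq_le_norm_lacunarySeries
      (fun k => lp.norm_apply_le_norm ENNReal.top_ne_zero d k) hd x).and_eventually
      -- Beyond the degree of `P` the polynomial no longer contributes to the derivatives.
      (eventually_gt_atTop P.natDegree)).mono fun n ⟨hn, hdeg⟩ => ?_
    rwa [der_add le_top _ _ hx, der_polyLM P le_top hx, der_lacunaryCLM _ d le_top hx,
      iterate_derivative_eq_zero hdeg, polyFun, eval_zero, zero_add]

end Main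

theorem theorem4p7 :
    (∀ (𝕜 : Type) [RCLike 𝕜],
      (∀ p : ℕ, MaximalDenseLineable 𝕜
        {f : CpSpace 𝕜 (p : ℕ∞) |
          ∀ x ∈ Icc (0 : ℝ) 1, ¬ DifferentiableWithinAt ℝ (f.der p) (Icc 0 1) x}) ∧
      MaximalDenseLineable 𝕜
        {f : CpSpace 𝕜 (⊤ : ℕ∞) | ∀ x ∈ Icc (0 : ℝ) 1, ¬ f.IsAnalyticAt x}) ∧
    MaximalDenseLineable ℂ
      {f : CpSpace ℂ (⊤ : ℕ∞) | ∀ x ∈ Icc (0 : ℝ) 1, f.HasPringsheimSingularityAt x} :=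
  ⟨fun 𝕜 _ => ⟨CpSpace.maximalDenseLineable_nowhere_differentiable 𝕜,
    (CpSpace.maximalDenseLineable_factorial_growth 𝕜).mono fun _ hf x hx =>
      CpSpace.not_isAnalyticAt_of_frequently hx (hf x hx)⟩,
    (CpSpace.maximalDenseLineable_factorial_growth ℂ).mono fun _ hf x hx =>
      CpSpace.hasPringsheimSingularityAt_of_frequently (hf x hx)⟩
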